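/- Consider the additive exponential noise channel $Y_i = X_i + N_i$, where the $N_i$ are i.i.d. exponential with mean $E_N > 0$, with input constraint $\frac1n \mathbb{E}\big[\sum_{i=1}^n X_i\big] \le E_X$ (expectation over a uniformly distributed message). Let $L_1, L_2 \ge 0$ be integers. For $-L_1 \le l \le L_2$ put $q_l = 1/(1+e^{2^l/E_N})$, the probability that the binary digit of weight $2^l$ of the noise is one, and let $p_l \in [0,1/2]$ satisfy $\sum_{l=-L_1}^{L_2} 2^l p_l \le E_X$. Write $H(p) = -p\log_2 p-(1-p)\log_2(1-p)$ and $p\otimes q = p(1-q)+q(1-p)$. An expansion modulation code of length $n$ consists of one binary code of length $n$ (encoder and decoder) for each level $l=-L_1,\dots,L_2$. A message is a tuple of messages, one for each level. The channel input is $X_i=\sum_{l=-L_1}^{L_2} 2^l X_{i,l}$, where $(X_{i,l})_{i\le n}$ is the codeword at level $l$. With $Y_{i,l}$ the binary digit of weight $2^l$ of $Y_i$, the receiver works from $l=-L_1$ upward. It starts from the carryovers $C_{i,-L_1}=0$. At level $l$ it applies the level-$l$ decoder to $(Y_{i,l}\oplus C_{i,l})_{i\le n}$, re-encodes the decoded message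 to get $\hat X_{i,l}$, computes $\hat N_{i,l} = Y_{i,l}\oplus C_{i,l}\oplus \hat X_{i,l}$, and takes for $C_{i,l+1}$ the carry (the majority) of the three bits $\hat X_{i,l}, \hat N_{i,l}, C_{i,l}$. Then expansion modulation with this successive decoding of the carryovers achieves the rate $$R_2=\sum_{l=-L_1}^{L_2}\big[H(p_l\otimes q_l)-H(q_l)\big]$$ in bits per channel use. That is, for all $\delta,\varepsilon>0$ and all sufficiently large $n$ there is an expansion modulation code of length $n$ with the following properties. For every level $l$, the expected fraction of ones in the level-$l$ codeword of a uniformly distributed message lies in $[p_l-\delta,\,p_l]$. The number $M$ of messages satisfies $\frac1n\log_2 M\ge R_2-\delta$. The input constraint holds. The average probability of error of the decoder above is at most $\varepsilon$ on the exponential noise channel, and also on the channel whose i.i.d. noise is $N_i=\sum_{l=-L_1}^{L_2}2^l N_{i,l}$ with independent bits such that $\Pr\{N_{i,l}=1\}=q_l$. -/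

import Mathlib

open MeasureTheory ProbabilityTheory Filter

noncomputable section

namespace ExpansionModulation

/-- Binary entropy in bits: `H(p) = -p log₂ p - (1 - p) log₂ (1 - p)`. -/
def entropyBits (p : ℝ) : ℝ := Real.binEntropy p / Real.log 2

/-- Binary convolution `p ⊗ q = p (1 - q) + q (1 - p)`. -/
def binConv (p q : ℝ) : ℝ := p * (1 - q) + q * (1 - p)

/-- `q_l = 1 / (1 + exp (2^l / E_N))`, the probability that the binary digit of weight `2^l` of
an exponential random variable with mean `E_N` is one. -/
def noiseProb (E_N : ℝ) (l : ℤ) : ℝ := 1 / (1 + Real.exp ((2 : ℝ) ^ l / E_N))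

/-- The levels `-L₁, …, L₂`. -/
abbrev levels (L₁ L₂ : ℕ) : Finset ℤ := Finset.Icc (-(L₁ : ℤ)) (L₂ : ℤ)

/-- The rate `R₂ = ∑_{l = -L₁}^{L₂} [H(p_l ⊗ q_l) - H(q_l)]`, in bits per channel use. -/
def rateTwo (E_N : ℝ) (L₁ L₂ : ℕ) (p : ℤ → ℝ) : ℝ :=
  ∑ l ∈ levels L₁ L₂,
    (entropyBits (binConv (p l) (noiseProb E_N l)) - entropyBits (noiseProb E_N l))

/-! ### Channels with additive noise -/

/-- The value of a bit, as a real number. -/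
def bitVal (b : Bool) : ℝ := if b then 1 else 0

/-- The law of the additive exponential noise with mean `E_N`
(density `(1 / E_N) exp (-x / E_N)` on `x ≥ 0`). -/
def expNoise (E_N : ℝ) : Measure ℝ := expMeasure (1 / E_N)

/-- The Bernoulli law on bits with `Pr{true} = q`. -/
def bernoulliLaw (q : ℝ) : Measure Bool :=
  ENNReal.ofReal (1 - q) • Measure.dirac false + ENNReal.ofReal q • Measure.dirac true

/-- The law of the noise restricted to the levels `-L₁, …, L₂`:
`N = ∑_l 2^l N_l` with independent `N_l` such that `Pr{N_l = 1} = q_l`. -/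
def levelNoise (E_N : ℝ) (L₁ L₂ : ℕ) : Measure ℝ :=
  (Measure.pi fun l : levels L₁ L₂ => bernoulliLaw (noiseProb E_N l)).map
    fun N => ∑ l : levels L₁ L₂, (2 : ℝ) ^ (l : ℤ) * bitVal (N l)

/-- Average probability of error of the encoder `f` and the decoder `g` over the memoryless
channel `Y_i = X_i + N_i`, where the `N_i` are independent with law `ν`:
`P_e = (1 / |𝓜|) ∑_m Pr{g(f(m) + N) ≠ m}`. -/
def avgError (ν : Measure ℝ) {n : ℕ} {Msg : Type} [Fintype Msg]
    (f : Msg → Fin n → ℝ) (g : (Fin n → ℝ) → Msg) : ℝ :=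
  (∑ m : Msg, (Measure.pi fun _ : Fin n => ν).real {N | g (fun i => f m i + N i) ≠ m}) /
    (Fintype.card Msg : ℝ)

/-! ### Expansion modulation -/

/-- A binary block code of length `n` with `size` messages, together with its decoder. -/
structure BinaryCode (n : ℕ) where
  /-- The number of messages. -/
  size : ℕ
  /-- The encoder. -/
  enc : Fin size → Fin n → Bool
  /-- The decoder. -/
  dec : (Fin n → Bool) → Fin size

/-- The expected fraction of ones in the codeword of a uniformly distributed message. -/
def BinaryCode.onesFraction {n : ℕ} (c : BinaryCode n) : ℝ :=
  (∑ m : Fin c.size, (∑ i : Fin n, bitVal (c.enc m i)) / (n : ℝ)) / (c.size : ℝ)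

/-- An expansion modulation code of length `n` on the levels `-L₁, …, L₂`: one binary code for
each level (the values at the other integers are never used). -/
abbrev EMCode (n : ℕ) := ℤ → BinaryCode n

variable {n : ℕ} (c : EMCode n) (L₁ L₂ : ℕ)

/-- A message of the modulation is a tuple of messages, one for each level. -/
abbrev EMCode.Msg : Type := (l : levels L₁ L₂) → Fin (c l).size

/-- The channel input: `X_i = ∑_l 2^l X_{i,l}`, where `X_{·,l}` is the codeword at level `l`. -/
def EMCode.encode (m : c.Msg L₁ L₂) (i : Fin n) : ℝ :=
  ∑ l : levels L₁ L₂, (2 : ℝ) ^ (l : ℤ) * bitVal ((c l).enc (m l) i)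

/-- The binary digit of weight `2^l` of the real number `y`. -/
def digit (l : ℤ) (y : ℝ) : Bool := decide (⌊y / (2 : ℝ) ^ l⌋ % 2 = 1)

/-- The carry-over of the addition of three bits. -/
def carryOut (x z d : Bool) : Bool := (x && z) || (x && d) || (z && d)

/-- The message decoded at level `l` from the digits of the output `y`, once the carry-overs `C`
into level `l` have been removed. -/
def EMCode.decodeLevel (l : ℤ) (C : Fin n → Bool) (y : Fin n → ℝ) : Fin (c l).size :=
  (c l).dec fun i => xor (digit l (y i)) (C i)

/-- `c.carry L₁ y j` is the sequence of carry-overs into level `-L₁ + j` as computed by the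
receiver from the output `y`, from the least significant level upward. There is no carry-over into
level `-L₁`. At each level `l` the receiver decodes and re-encodes the message, obtains the noise
bits as `N_{i,l} = Y_{i,l} ⊕ C_{i,l} ⊕ X_{i,l}`, and finds from the triples
`(X_{i,l}, N_{i,l}, C_{i,l})` the carry-overs into level `l + 1`. -/
def EMCode.carry (y : Fin n → ℝ) : ℕ → Fin n → Bool
  | 0 => fun _ => false
  | j + 1 => fun i =>
    let l : ℤ := -(L₁ : ℤ) + j
    let C : Fin n → Bool := EMCode.carry y j
    let X : Fin n → Bool := (c l).enc (c.decodeLevel l C y)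
    let N : Bool := xor (xor (digit l (y i)) (C i)) (X i)
    carryOut (X i) N (C i)

/-- The successive decoder: each level is decoded after the removal of the carry-overs computed
from the levels below it. -/
def EMCode.decode (y : Fin n → ℝ) : c.Msg L₁ L₂ := fun l =>
  c.decodeLevel l (c.carry L₁ y ((l : ℤ) + L₁).toNat) y

/-- The rate `(1 / n) log₂ |𝓜|` of the code, in bits per channel use. -/
def EMCode.rate : ℝ := Real.logb 2 (Fintype.card (c.Msg L₁ L₂)) / (n : ℝ)

/-- The mean input `(1 / n) E[∑_i X_i]` for a uniformly distributed message. -/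
def EMCode.meanInput : ℝ :=
  (∑ m : c.Msg L₁ L₂, (∑ i : Fin n, c.encode L₁ L₂ m i) / (n : ℝ)) /
    (Fintype.card (c.Msg L₁ L₂) : ℝ)

/-- Expansion modulation on the levels `-L₁, …, L₂` with input probabilities `p_l`, decoded
successively with the carry-overs, achieves the rate `R` under the input constraint `E_X`.
For all `δ, ε > 0` and all large block lengths there is such a code whose fraction of ones at each
level `l` is within `δ` of (and at most) `p_l`, whose rate is at least `R - δ`, which satisfies the
input constraint, and whose average probability of error is at most `ε` over the additive
exponential noise channel and over the channel with the noise restricted to these levels. -/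
def EMAchieves (E_N E_X : ℝ) (L₁ L₂ : ℕ) (p : ℤ → ℝ) (R : ℝ) : Prop :=
  ∀ δ > 0, ∀ ε > 0, ∀ᶠ n : ℕ in atTop, ∃ c : EMCode n,
    (∀ l ∈ levels L₁ L₂, p l - δ ≤ (c l).onesFraction ∧ (c l).onesFraction ≤ p l) ∧
    R - δ ≤ c.rate L₁ L₂ ∧
    c.meanInput L₁ L₂ ≤ E_X ∧
    avgError (expNoise E_N) (c.encode L₁ L₂) (c.decode L₁ L₂) ≤ ε ∧
    avgError (levelNoise E_N L₁ L₂) (c.encode L₁ L₂) (c.decode L₁ L₂) ≤ ε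

end ExpansionModulation

end

namespace ExpansionModulation

/-! The input is a multiple of `2^(-L₁)`, so the noise below level `-L₁` causes no carry into that
level. From there upward, output digit = input digit ⊕ noise digit ⊕ carry. If all lower levels are
decoded correctly, the receiver's carries are the true ones (`decode_encode_add`), and level `l`
becomes a binary symmetric channel with crossover probability `q_l`. Thus decoding can fail only if
some level code fails on its own noise digits. The union bound over levels needs only the marginal
law of each digit, never independence across levels, and hence covers both noises at once. The
exponential law has the right digit marginals because it is memoryless (`map_digit_expNoise`).

What remains is a coding theorem for the binary symmetric channel in which every codeword has
relative weight in `[p - δ, p]` (`exists_code_weight_le`). It comes from Feinstein's maximal code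
construction, with codewords restricted to a typical set and decoding sets cut out by a likelihood
ratio threshold. Chebyshev's inequality controls both the weight and the information density. -/

/-- The Bernoulli weights on bits, as real numbers. -/
noncomputable def bern (q : ℝ) (b : Bool) : ℝ := if b then q else 1 - q

/-! ### Feinstein's greedy code construction -/

/-- Feinstein's greedy construction of a code for the channel `W`, with codewords in `S` and
decoding sets inside the sets `A x`. -/
theorem exists_feinstein_code {X Y : Type*} [Fintype X] [Fintype Y] [DecidableEq Y] [Nonempty X]
    (P : X → ℝ) (W : X → Y → ℝ) (S : Finset X) (A : X → Finset Y) {γ ε : ℝ}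
    (hP : ∀ x, 0 ≤ P x) (hP1 : ∑ x, P x = 1) (hW : ∀ x y, 0 ≤ W x y)
    (hγ : 0 < γ) (hε : ε ≤ 1)
    (hA : ∀ x, ∑ y ∈ A x, ∑ x', P x' * W x' y ≤ 1 / γ)
    (hS : 1 - ε / 2 ≤ ∑ x ∈ S, P x * ∑ y ∈ A x, W x y) :
    ∀ k : ℕ, (k : ℝ) < γ * (ε / 2) + 1 → ∃ (enc : ℕ → X) (dec : Y → ℕ), ∀ j < k,
      enc j ∈ S ∧ 1 - ε ≤ ∑ y with dec y = j, W (enc j) y ∧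
        ∀ y, dec y = j → y ∈ A (enc j) := by
  intro k
  induction k with
  | zero => exact fun _ => ⟨fun _ => Classical.arbitrary X, fun _ => 0, by simp⟩
  | succ k ih =>
    intro hk
    push_cast at hk
    obtain ⟨enc, dec, h⟩ := ih (by linarith)
    -- The outputs already assigned; a value of `dec` that is at least `k` means that the output is
    -- free.
    set D : Finset Y := {y | dec y < k} with hD
    have hR : ∀ y, 0 ≤ ∑ x', P x' * W x' y :=
      fun y => Finset.sum_nonneg fun x _ => mul_nonneg (hP x) (hW x y)
    -- Each of the `k` decoding sets lies in some `A x`, of output mass at most `1 / γ`, and `k + 1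
    -- < γ * (ε / 2) + 1`.
    have hDR : ∑ y ∈ D, ∑ x', P x' * W x' y < ε / 2 := by
      have hmaps : ∀ y ∈ D, dec y ∈ Finset.range k := fun y hy => by simpa [hD] using hy
      rw [← Finset.sum_fiberwise_of_maps_to hmaps]
      calc ∑ j ∈ Finset.range k, ∑ y ∈ D with dec y = j, ∑ x', P x' * W x' y
          ≤ ∑ j ∈ Finset.range k, 1 / γ := by
            refine Finset.sum_le_sum fun j hj => le_trans ?_ (hA (enc j))
            refine Finset.sum_le_sum_of_subset_of_nonneg (fun y hy => ?_) fun y _ _ => hR y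
            exact (h j (Finset.mem_range.1 hj)).2.2 y (Finset.mem_filter.1 hy).2
        _ = k / γ := by simp [div_eq_mul_inv]
        _ < ε / 2 := by rw [div_lt_iff₀ hγ]; linarith
    -- Otherwise averaging over `P` bounds the sum in `hS` by `1 - ε` plus the output mass of `D`,
    -- which is less than `1 - ε / 2`.
    have hx : ∃ x ∈ S, 1 - ε ≤ ∑ y ∈ A x \ D, W x y := by
      by_contra! hcon
      have h1 : ∀ x ∈ S, P x * ∑ y ∈ A x, W x y ≤ P x * (1 - ε) + P x * ∑ y ∈ D, W x y := by
        intro x hx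
        rw [← mul_add]
        refine mul_le_mul_of_nonneg_left ?_ (hP x)
        have h2 : ∑ y ∈ A x, W x y ≤ ∑ y ∈ A x \ D, W x y + ∑ y ∈ D, W x y := by
          rw [← Finset.sum_union Finset.sdiff_disjoint]
          exact Finset.sum_le_sum_of_subset_of_nonneg (by simp) fun y _ _ => hW x y
        linarith [hcon x hx]
      have h3 := Finset.sum_le_sum h1
      rw [Finset.sum_add_distrib, ← Finset.sum_mul] at h3
      have h4 : ∑ x ∈ S, P x ≤ 1 :=
        hP1 ▸ Finset.sum_le_sum_of_subset_of_nonneg (Finset.subset_univ S) fun x _ _ => hP x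
      have h5 : ∑ x ∈ S, P x * ∑ y ∈ D, W x y ≤ ∑ y ∈ D, ∑ x', P x' * W x' y := by
        rw [Finset.sum_comm]
        simp_rw [← Finset.mul_sum]
        exact Finset.sum_le_sum_of_subset_of_nonneg (Finset.subset_univ S)
          fun x _ _ => mul_nonneg (hP x) (Finset.sum_nonneg fun y _ => hW x y)
      have h6 : (∑ x ∈ S, P x) * (1 - ε) ≤ 1 * (1 - ε) :=
        mul_le_mul_of_nonneg_right h4 (by linarith)
      linarith
    obtain ⟨x, hxS, hx⟩ := hx
    -- The value `k + 1` keeps the remaining outputs free: it is not below the new number of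
    -- codewords.
    refine ⟨Function.update enc k x,
      fun y => if dec y < k then dec y else if y ∈ A x then k else k + 1, fun j hj => ?_⟩
    rcases Nat.lt_succ_iff_lt_or_eq.1 hj with hj | rfl
    · rw [Function.update_of_ne hj.ne]
      have hiff : ∀ y, (if dec y < k then dec y else if y ∈ A x then k else k + 1) = j ↔
          dec y = j := by
        intro y
        split_ifs <;> omega
      simp only [hiff]
      exact h j hj
    · have hiff : ∀ y, (if dec y < j then dec y else if y ∈ A x then j else j + 1) = j ↔
          y ∈ A x \ D := by
        intro y
        simp only [hD, Finset.mem_sdiff, Finset.mem_filter, Finset.mem_univ, true_and]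
        split_ifs <;> simp_all; omega
      simp only [hiff, Function.update_self]
      refine ⟨hxS, ?_, fun y hy => (Finset.mem_sdiff.1 hy).1⟩
      convert hx using 2
      ext y
      simp

/-! ### Moments of sums under product weights -/

/-- Product weights add up to one. -/
theorem sum_prod_eq_one {α : Type*} [Fintype α] {w : α → ℝ} (hw : ∑ a, w a = 1) (n : ℕ) :
    ∑ x : Fin n → α, ∏ i, w (x i) = 1 := by
  classical
  rw [← Fintype.piFinset_univ, Finset.sum_prod_piFinset]
  simp [hw]

/-- The variance of a sum of `n` independent centred variables. -/
theorem sum_prod_mul_sq {α : Type*} [Fintype α] {w f : α → ℝ} (hw : ∑ a, w a = 1)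
    (hf : ∑ a, w a * f a = 0) (n : ℕ) :
    ∑ x : Fin n → α, (∏ i, w (x i)) * (∑ i, f (x i)) ^ 2 = n * ∑ a, w a * f a ^ 2 := by
  -- The first moment is needed for the cross term when the square is split at the first coordinate.
  have hmean : ∀ n : ℕ, ∑ x : Fin n → α, (∏ i, w (x i)) * ∑ i, f (x i) = 0 := by
    intro n
    induction n with
    | zero => simp
    | succ n ih =>
      rw [← (Fin.consEquiv fun _ => α).sum_comp, Fintype.sum_prod_type]
      simp only [Fin.consEquiv_apply, Fin.prod_univ_succ, Fin.sum_univ_succ, Fin.cons_zero,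
        Fin.cons_succ]
      have : ∀ (a : α) (x : Fin n → α), w a * (∏ i, w (x i)) * (f a + ∑ i, f (x i)) =
          w a * f a * (∏ i, w (x i)) + w a * ((∏ i, w (x i)) * ∑ i, f (x i)) := by
        intros; ring
      simp only [this, Finset.sum_add_distrib, ← Finset.mul_sum, ih, sum_prod_eq_one hw]
      simp [hf]
  induction n with
  | zero => simp
  | succ n ih =>
    rw [← (Fin.consEquiv fun _ => α).sum_comp, Fintype.sum_prod_type]
    simp only [Fin.consEquiv_apply, Fin.prod_univ_succ, Fin.sum_univ_succ, Fin.cons_zero,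
      Fin.cons_succ]
    have : ∀ (a : α) (x : Fin n → α), w a * (∏ i, w (x i)) * (f a + ∑ i, f (x i)) ^ 2 =
        w a * f a ^ 2 * (∏ i, w (x i)) + 2 * (w a * f a) * ((∏ i, w (x i)) * ∑ i, f (x i)) +
          w a * ((∏ i, w (x i)) * (∑ i, f (x i)) ^ 2) := by
      intros; ring
    simp only [this, Finset.sum_add_distrib, ← Finset.mul_sum, ih, hmean, sum_prod_eq_one hw]
    simp only [mul_one, mul_zero, Finset.sum_const_zero, add_zero, ← Finset.sum_mul, hw]
    push_cast
    ring

/-- Chebyshev's inequality for a sum of `n` independent centred variables. -/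
theorem sum_prod_filter_le {α : Type*} [Fintype α] {w f : α → ℝ} (hw0 : ∀ a, 0 ≤ w a)
    (hw : ∑ a, w a = 1) (hf : ∑ a, w a * f a = 0) {n : ℕ} (hn : 0 < n) {η : ℝ} (hη : 0 < η) :
    ∑ x : Fin n → α with n * η ≤ |∑ i, f (x i)|, ∏ i, w (x i) ≤
      (∑ a, w a * f a ^ 2) / η ^ 2 / n := by
  have hn' : (0 : ℝ) < n := Nat.cast_pos.2 hn
  have hpos : 0 < n * η := by positivity
  have h : (n * η) ^ 2 * ∑ x : Fin n → α with n * η ≤ |∑ i, f (x i)|, ∏ i, w (x i) ≤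
      n * ∑ a, w a * f a ^ 2 := by
    rw [← sum_prod_mul_sq hw hf, Finset.mul_sum]
    refine (Finset.sum_le_sum fun x hx => ?_).trans
      (Finset.sum_le_sum_of_subset_of_nonneg (Finset.subset_univ _) fun x _ _ =>
        mul_nonneg (Finset.prod_nonneg fun i _ => hw0 _) (sq_nonneg _))
    rw [mul_comm]
    refine mul_le_mul_of_nonneg_left ?_ (Finset.prod_nonneg fun i _ => hw0 _)
    rw [← sq_abs (∑ i, f (x i))]
    exact pow_le_pow_left₀ hpos.le (Finset.mem_filter.1 hx).2 2
  rw [div_div, le_div_iff₀ (by positivity)]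
  refine le_of_mul_le_mul_left ?_ hn'
  linarith

/-! ### Coding for the binary symmetric channel -/

theorem bern_pos {q : ℝ} (h0 : 0 < q) (h1 : q < 1) (b : Bool) : 0 < bern q b := by
  cases b <;> simp [bern] <;> linarith

theorem sum_bern (q : ℝ) : ∑ b, bern q b = 1 := by
  simp [bern]

theorem sum_bern_xor (q : ℝ) (a : Bool) : ∑ b, bern q (xor a b) = 1 := by
  cases a <;> simp [bern]

/-- The output law of the binary symmetric channel with a Bernoulli input. -/
theorem sum_bern_mul_bern_xor (p q : ℝ) (b : Bool) :
    ∑ a, bern p a * bern q (xor a b) = bern (binConv p q) b := by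
  cases b <;> simp [bern, binConv] <;> ring

theorem binConv_pos {p q : ℝ} (hp : 0 < p) (hp1 : p < 1) (hq : 0 < q) (hq1 : q < 1) :
    0 < binConv p q :=
  add_pos (mul_pos hp (sub_pos.2 hq1)) (mul_pos hq (sub_pos.2 hp1))

theorem binConv_lt_one {p q : ℝ} (hp : 0 < p) (hp1 : p < 1) (hq : 0 < q) (hq1 : q < 1) :
    binConv p q < 1 := by
  have h1 := mul_pos hp hq
  have h2 := mul_pos (sub_pos.2 hp1) (sub_pos.2 hq1)
  unfold binConv
  linarith

/-- The joint weights of the input and the output of the binary symmetric channel. -/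
noncomputable def jointBern (p q : ℝ) (u : Bool × Bool) : ℝ :=
  bern p u.1 * bern q (xor u.1 u.2)

/-- The information density (in nats) of the binary symmetric channel. -/
noncomputable def infoDensity (p q : ℝ) (u : Bool × Bool) : ℝ :=
  Real.log (bern q (xor u.1 u.2)) - Real.log (bern (binConv p q) u.2)

theorem sum_jointBern (p q : ℝ) : ∑ u, jointBern p q u = 1 := by
  simp only [Fintype.sum_prod_type, jointBern, ← Finset.mul_sum, sum_bern_xor, mul_one, sum_bern]

theorem jointBern_nonneg {p q : ℝ} (hp : 0 < p) (hp1 : p < 1) (hq : 0 < q) (hq1 : q < 1)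
    (u : Bool × Bool) : 0 ≤ jointBern p q u :=
  (mul_pos (bern_pos hp hp1 _) (bern_pos hq hq1 _)).le

/-- The mean information density is the mutual information, which is where the rate comes from. -/
theorem sum_jointBern_mul_infoDensity (p q : ℝ) :
    ∑ u, jointBern p q u * infoDensity p q u =
      Real.binEntropy (binConv p q) - Real.binEntropy q := by
  simp only [Real.binEntropy, Real.log_inv, Fintype.sum_prod_type, jointBern, infoDensity,
    Fintype.sum_bool, bern]
  simp only [Bool.xor_true, Bool.xor_false, Bool.not_true, Bool.not_false, if_true,
    Bool.false_eq_true, if_false]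
  -- With the logarithms as atoms, unfolding `binConv` leaves a polynomial identity.
  generalize hr : binConv p q = r
  generalize Real.log r = A
  generalize Real.log (1 - r) = B
  rw [← hr, binConv]
  ring

theorem sum_jointBern_mul_sub (p q c : ℝ) (f : Bool × Bool → ℝ)
    (hf : ∑ u, jointBern p q u * f u = c) : ∑ u, jointBern p q u * (f u - c) = 0 := by
  simp only [mul_sub, Finset.sum_sub_distrib, ← Finset.sum_mul, sum_jointBern, hf]
  ring

theorem sum_jointBern_mul_bitVal (p q : ℝ) : ∑ u, jointBern p q u * bitVal u.1 = p := by
  simp [Fintype.sum_prod_type, jointBern, bern, bitVal]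
  ring

/-- Codes for the binary symmetric channel whose codewords all have about the weight `n p`, of rate
close to the mutual information and with a small maximal probability of error. -/
theorem exists_code_bsc {p q : ℝ} (hp : 0 < p) (hp1 : p < 1) (hq : 0 < q) (hq1 : q < 1)
    {δ η ε : ℝ} (hδ : 0 < δ) (hη : 0 < η) (hε : 0 < ε) (hε1 : ε ≤ 1) :
    ∀ᶠ n : ℕ in atTop, ∃ c : BinaryCode n,
      (∀ m, |∑ i, (bitVal (c.enc m i) - p)| < n * η) ∧
      n * (Real.binEntropy (binConv p q) - Real.binEntropy q - δ) + Real.log (ε / 2) ≤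
        Real.log c.size ∧
      ∀ m, 1 - ε ≤ ∑ y with c.dec y = m, ∏ i, bern q (xor (c.enc m i) (y i)) := by
  set I : ℝ := Real.binEntropy (binConv p q) - Real.binEntropy q with hI
  set r := binConv p q with hr
  have hr0 : 0 < r := binConv_pos hp hp1 hq hq1
  have hr1 : r < 1 := binConv_lt_one hp hp1 hq hq1
  set f₁ : Bool × Bool → ℝ := fun u => bitVal u.1 - p
  set f₂ : Bool × Bool → ℝ := fun u => infoDensity p q u - I
  set V₁ := (∑ a, jointBern p q a * f₁ a ^ 2) / η ^ 2
  -- `V₁ / n` and `V₂ / n` are the Chebyshev bounds for an atypical weight and an atypical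
  -- information density.
  set V₂ := (∑ a, jointBern p q a * f₂ a ^ 2) / δ ^ 2
  have hlim : Tendsto (fun n : ℕ => V₁ / (n : ℝ) + V₂ / (n : ℝ)) atTop (nhds 0) := by
    simpa using (tendsto_const_div_atTop_nhds_zero_nat V₁).add
      (tendsto_const_div_atTop_nhds_zero_nat V₂)
  filter_upwards [eventually_gt_atTop 0, hlim.eventually_lt_const (half_pos hε)] with n hn hV
  set γ : ℝ := Real.exp (n * (I - δ)) with hγdef
  have hγ : 0 < γ := Real.exp_pos _
  set P : (Fin n → Bool) → ℝ := fun x => ∏ i, bern p (x i)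
  set W : (Fin n → Bool) → (Fin n → Bool) → ℝ := fun x y => ∏ i, bern q (xor (x i) (y i))
  set R : (Fin n → Bool) → ℝ := fun y => ∏ i, bern r (y i)
  have hPpos : ∀ x, 0 < P x := fun x => Finset.prod_pos fun i _ => bern_pos hp hp1 _
  have hWpos : ∀ x y, 0 < W x y := fun x y => Finset.prod_pos fun i _ => bern_pos hq hq1 _
  have hRpos : ∀ y, 0 < R y := fun y => Finset.prod_pos fun i _ => bern_pos hr0 hr1 _
  have hW1 : ∀ x, ∑ y, W x y = 1 := by
    intro x
    simp only [W]
    rw [← Fintype.piFinset_univ,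
      ← Finset.prod_univ_sum (fun _ => Finset.univ) fun i b => bern q (xor (x i) b)]
    simp only [sum_bern_xor, Finset.prod_const_one]
  have hPW : ∀ y, ∑ x, P x * W x y = R y := by
    intro y
    simp only [P, W, R, ← Finset.prod_mul_distrib]
    rw [← Fintype.piFinset_univ,
      ← Finset.prod_univ_sum (fun _ => Finset.univ) fun i a => bern p a * bern q (xor a (y i))]
    simp only [sum_bern_mul_bern_xor, hr]
  set S : Finset (Fin n → Bool) := {x | |∑ i, (bitVal (x i) - p)| < n * η}
  set A : (Fin n → Bool) → Finset (Fin n → Bool) := fun x => {y | γ * R y ≤ W x y}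
  -- Change of measure: on `A x` the output law is at most `W x / γ`, and `W x` has total mass one.
  have hA : ∀ x, ∑ y ∈ A x, ∑ x', P x' * W x' y ≤ 1 / γ := by
    intro x
    simp only [hPW]
    rw [le_div_iff₀ hγ, mul_comm, Finset.mul_sum, ← hW1 x]
    exact (Finset.sum_le_sum fun y hy => (Finset.mem_filter.1 hy).2).trans
      (Finset.sum_le_sum_of_subset_of_nonneg (Finset.subset_univ _) fun y _ _ => (hWpos x y).le)
  have hS : 1 - ε / 2 ≤ ∑ x ∈ S, P x * ∑ y ∈ A x, W x y := by
    have h1 := sum_prod_filter_le (jointBern_nonneg hp hp1 hq hq1) (sum_jointBern p q)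
      (sum_jointBern_mul_sub p q p _ (sum_jointBern_mul_bitVal p q)) hn hη
    have h2 := sum_prod_filter_le (jointBern_nonneg hp hp1 hq hq1) (sum_jointBern p q)
      (sum_jointBern_mul_sub p q I _ (sum_jointBern_mul_infoDensity p q)) hn hδ
    have h3 := sum_prod_eq_one (sum_jointBern p q) n
    have h4 : ∑ x ∈ S, P x * ∑ y ∈ A x, W x y = ∑ u : Fin n → Bool × Bool,
        if (fun i => (u i).1) ∈ S ∧ (fun i => (u i).2) ∈ A fun i => (u i).1 then
          ∏ i, jointBern p q (u i) else 0 := by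
      rw [← (Equiv.arrowProdEquivProdArrow (Fin n) (fun _ => Bool) (fun _ => Bool)).symm.sum_comp,
        Fintype.sum_prod_type, ← Finset.sum_subset (Finset.subset_univ S)]
      · refine Finset.sum_congr rfl fun x hx => ?_
        rw [← Finset.sum_subset (Finset.subset_univ (A x)), Finset.mul_sum]
        · refine Finset.sum_congr rfl fun y hy => ?_
          rw [if_pos ⟨hx, hy⟩, ← Finset.prod_mul_distrib]
          rfl
        · exact fun y _ hy => if_neg fun h => hy h.2
      · exact fun x _ hx => Finset.sum_eq_zero fun y _ => if_neg fun h => hx h.1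
    rw [h4]
    -- Pointwise union bound: a pair of words is good unless one of the two sums deviates.
    have h5 : ∀ u : Fin n → Bool × Bool, ∏ i, jointBern p q (u i) ≤
        (if (fun i => (u i).1) ∈ S ∧ (fun i => (u i).2) ∈ A fun i => (u i).1 then
          ∏ i, jointBern p q (u i) else 0) +
        ((if n * η ≤ |∑ i, f₁ (u i)| then ∏ i, jointBern p q (u i) else 0) +
        (if n * δ ≤ |∑ i, f₂ (u i)| then ∏ i, jointBern p q (u i) else 0)) := by
      intro u
      have hJ : 0 ≤ ∏ i, jointBern p q (u i) :=
        Finset.prod_nonneg fun i _ => jointBern_nonneg hp hp1 hq hq1 _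
      by_cases hb1 : n * η ≤ |∑ i, f₁ (u i)|
      · rw [if_pos hb1]
        split_ifs <;> linarith
      by_cases hb2 : n * δ ≤ |∑ i, f₂ (u i)|
      · rw [if_pos hb2]
        split_ifs <;> linarith
      rw [if_pos]
      · split_ifs; linarith
      refine ⟨by simpa [S, f₁] using not_le.1 hb1, ?_⟩
      simp only [A, Finset.mem_filter, Finset.mem_univ, true_and]
      have hlt := (abs_lt.1 (not_le.1 hb2)).1
      rw [← Real.exp_log (hRpos _), ← Real.exp_log (hWpos _ _), hγdef, ← Real.exp_add,
        Real.exp_le_exp]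
      simp only [R, W]
      rw [Real.log_prod fun i _ => (bern_pos hr0 hr1 _).ne',
        Real.log_prod fun i _ => (bern_pos hq hq1 _).ne']
      simp only [f₂, infoDensity, Finset.sum_sub_distrib, Finset.sum_const, Finset.card_univ,
        Fintype.card_fin, nsmul_eq_mul, ← hr] at hlt
      linarith
    have h6 := Finset.sum_le_sum fun u (_ : u ∈ Finset.univ) => h5 u
    rw [Finset.sum_add_distrib, Finset.sum_add_distrib, h3, ← Finset.sum_filter,
      ← Finset.sum_filter, ← Finset.sum_filter] at h6
    rw [← Finset.sum_filter]
    linarith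
  have hpos : 0 < γ * (ε / 2) := by positivity
  -- The ceiling stays within Feinstein's bound and yields `log K ≥ n (I - δ) + log (ε / 2)`.
  set K := ⌈γ * (ε / 2)⌉₊ with hK
  have hK0 : 0 < K := Nat.ceil_pos.2 hpos
  obtain ⟨enc, dec, hc⟩ := exists_feinstein_code P W S A (fun x => (hPpos x).le)
    (sum_prod_eq_one (sum_bern p) n) (fun x y => (hWpos x y).le) hγ hε1 hA hS K
    (Nat.ceil_lt_add_one hpos.le)
  -- Sending the free outputs to message `0` only enlarges a decoding set.
  refine ⟨⟨K, fun j => enc j, fun y => if h : dec y < K then ⟨dec y, h⟩ else ⟨0, hK0⟩⟩,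
    fun m => by simpa [S] using (hc m m.2).1, ?_, fun m => ?_⟩
  · rw [← Real.log_exp (n * (I - δ)), ← Real.log_mul (Real.exp_pos _).ne' (half_pos hε).ne']
    exact Real.log_le_log hpos (Nat.le_ceil _)
  · refine (hc m m.2).2.1.trans
      (Finset.sum_le_sum_of_subset_of_nonneg (fun y hy => ?_) fun y _ _ => (hWpos _ y).le)
    have hy' : dec y = m := (Finset.mem_filter.1 hy).2
    simp [hy']

/-! ### Binary digits and carries -/

/-- Above the lowest digit, the sum is twice a sum of the same shape for the shifted sequence. -/
theorem natSum_div_two_pow_mod_two (b : ℕ → Bool) (L j : ℕ) (hj : j < L) :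
    (∑ k ∈ Finset.range L, 2 ^ k * (b k).toNat) / 2 ^ j % 2 = (b j).toNat := by
  induction L generalizing b j with
  | zero => omega
  | succ L ih =>
    rw [Finset.sum_range_succ']
    simp only [pow_succ', mul_assoc, ← Finset.mul_sum, pow_zero, one_mul]
    have hb := Bool.toNat_le (b 0)
    cases j with
    | zero => rw [pow_zero, Nat.div_one]; omega
    | succ j =>
      rw [pow_succ', ← Nat.div_div_eq_div_mul, Nat.mul_add_div two_pos,
        show (b 0).toNat / 2 = 0 by omega, add_zero]
      exact ih (fun k => b (k + 1)) j (by omega)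

theorem sum_levels (L₁ L₂ : ℕ) (f : ℤ → ℝ) :
    ∑ l : levels L₁ L₂, f l = ∑ j ∈ Finset.range (L₁ + L₂ + 1), f (-(L₁ : ℤ) + j) := by
  rw [Finset.sum_coe_sort (levels L₁ L₂) f]
  symm
  refine Finset.sum_bij (fun j _ => -(L₁ : ℤ) + j) (fun j hj => ?_) (fun _ _ _ _ h => by omega)
    (fun l hl => ?_) fun _ _ => rfl
  · rw [Finset.mem_range] at hj
    rw [Finset.mem_Icc]
    omega
  · rw [Finset.mem_Icc] at hl
    exact ⟨(l + L₁).toNat, by rw [Finset.mem_range]; omega, by omega⟩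

/-- A sum of levels is a multiple of the least weight, whose multiplier has the given binary
digits. -/
theorem exists_nat_sum_levels (L₁ L₂ : ℕ) (b : levels L₁ L₂ → Bool) :
    ∃ T : ℕ, ∑ l : levels L₁ L₂, (2 : ℝ) ^ (l : ℤ) * bitVal (b l) = T * (2 : ℝ) ^ (-(L₁ : ℤ)) ∧
      ∀ (j : ℕ) (h : -(L₁ : ℤ) + j ∈ levels L₁ L₂), T / 2 ^ j % 2 = (b ⟨_, h⟩).toNat := by
  classical
  -- Extending the digits by `false` to all integers allows reindexing by natural numbers.
  set b' : ℤ → Bool := fun l => if h : l ∈ levels L₁ L₂ then b ⟨l, h⟩ else false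
  have hb' : ∀ l : levels L₁ L₂, b l = b' l := fun l => by simp only [b', dif_pos l.2]
  refine ⟨∑ j ∈ Finset.range (L₁ + L₂ + 1), 2 ^ j * (b' (-(L₁ : ℤ) + j)).toNat, ?_, ?_⟩
  · simp only [hb']
    rw [sum_levels L₁ L₂ fun l => (2 : ℝ) ^ l * bitVal (b' l)]
    push_cast
    rw [Finset.sum_mul]
    refine Finset.sum_congr rfl fun j _ => ?_
    rw [zpow_add₀ two_ne_zero, zpow_natCast]
    cases b' (-(L₁ : ℤ) + j) <;> simp [bitVal, mul_comm]
  · intro j h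
    rw [natSum_div_two_pow_mod_two (fun j => b' (-(L₁ : ℤ) + j)) _ _
      (by rw [Finset.mem_Icc] at h; omega), hb']

theorem floor_natCast_mul_div (T L₁ j : ℕ) :
    ⌊(T * (2 : ℝ) ^ (-(L₁ : ℤ))) / (2 : ℝ) ^ (-(L₁ : ℤ) + (j : ℤ))⌋ = ((T / 2 ^ j : ℕ) : ℤ) := by
  rw [zpow_add₀ two_ne_zero, mul_comm (T : ℝ), mul_div_mul_left _ _ (by positivity), zpow_natCast]
  have := Nat.floor_div_eq_div (K := ℝ) T (2 ^ j)
  push_cast at this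
  rw [← this, Int.natCast_floor_eq_floor (by positivity)]

/-- Used both for the channel input and for the noise restricted to the levels. -/
theorem digit_sum_levels (L₁ L₂ : ℕ) (b : levels L₁ L₂ → Bool) (l : levels L₁ L₂) :
    digit l (∑ k : levels L₁ L₂, (2 : ℝ) ^ (k : ℤ) * bitVal (b k)) = b l := by
  obtain ⟨l, hl⟩ := l
  obtain ⟨j, rfl⟩ : ∃ j : ℕ, l = -(L₁ : ℤ) + j :=
    ⟨(l + L₁).toNat, by rw [Finset.mem_Icc] at hl; omega⟩
  obtain ⟨T, hT, hd⟩ := exists_nat_sum_levels L₁ L₂ b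
  have h := hd j hl
  rw [digit, hT, floor_natCast_mul_div]
  generalize T / 2 ^ j = Q at h ⊢
  generalize b ⟨_, hl⟩ = v at h ⊢
  cases v
  · rw [decide_eq_false_iff_not]
    simp only [Bool.toNat_false] at h
    omega
  · rw [decide_eq_true_iff]
    simp only [Bool.toNat_true] at h
    omega

theorem floor_div_zpow_succ (y : ℝ) (l : ℤ) : ⌊y / (2 : ℝ) ^ (l + 1)⌋ = ⌊y / (2 : ℝ) ^ l⌋ / 2 := by
  rw [zpow_add_one₀ two_ne_zero, ← div_div]
  exact_mod_cast Int.floor_div_natCast (y / (2 : ℝ) ^ l) 2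

/-- The carry-overs of the binary addition of the noise `N` to the input `x`, from level `-L₁` on. -/
noncomputable def trueCarry (L₁ : ℕ) (x N : ℝ) : ℕ → Bool
  | 0 => false
  | j + 1 => carryOut (digit (-(L₁ : ℤ) + j) x) (digit (-(L₁ : ℤ) + j) N) (trueCarry L₁ x N j)

/-- At level `-L₁` the scaled input is the integer `T`, so the floors add without carry, whatever
finer digits `N` has. Going up one level halves all floors, and the parities decide the next carry.
-/
theorem floor_add_eq_add_trueCarry (L₁ T : ℕ) (N : ℝ) (j : ℕ) :
    ⌊(T * (2 : ℝ) ^ (-(L₁ : ℤ)) + N) / (2 : ℝ) ^ (-(L₁ : ℤ) + (j : ℤ))⌋ =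
      ⌊(T * (2 : ℝ) ^ (-(L₁ : ℤ))) / (2 : ℝ) ^ (-(L₁ : ℤ) + (j : ℤ))⌋ +
        ⌊N / (2 : ℝ) ^ (-(L₁ : ℤ) + (j : ℤ))⌋ +
          (trueCarry L₁ (T * (2 : ℝ) ^ (-(L₁ : ℤ))) N j).toNat := by
  induction j with
  | zero =>
    rw [floor_natCast_mul_div]
    simp only [Nat.cast_zero, add_zero, trueCarry, add_div, pow_zero, Nat.div_one]
    rw [mul_div_assoc, div_self (by positivity), mul_one, Int.floor_natCast_add]
    simp
  | succ j ih =>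
    push_cast
    simp only [← add_assoc, floor_div_zpow_succ, trueCarry, digit]
    rw [ih]
    generalize ⌊N / (2 : ℝ) ^ (-(L₁ : ℤ) + (j : ℤ))⌋ = B
    generalize ⌊(T * (2 : ℝ) ^ (-(L₁ : ℤ))) / (2 : ℝ) ^ (-(L₁ : ℤ) + (j : ℤ))⌋ = A
    cases trueCarry L₁ (T * (2 : ℝ) ^ (-(L₁ : ℤ))) N j <;>
      rcases Int.emod_two_eq_zero_or_one A with hA | hA <;>
      rcases Int.emod_two_eq_zero_or_one B with hB | hB <;>
      simp [carryOut, hA, hB] <;> omega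

/-- The digits of the channel output are obtained from those of the input and of the noise and from
the carry-overs. -/
theorem digit_add (L₁ T : ℕ) (N : ℝ) (j : ℕ) :
    digit (-(L₁ : ℤ) + j) (T * (2 : ℝ) ^ (-(L₁ : ℤ)) + N) =
      xor (xor (digit (-(L₁ : ℤ) + j) (T * (2 : ℝ) ^ (-(L₁ : ℤ)))) (digit (-(L₁ : ℤ) + j) N))
        (trueCarry L₁ (T * (2 : ℝ) ^ (-(L₁ : ℤ))) N j) := by
  simp only [digit]
  rw [floor_add_eq_add_trueCarry]
  generalize ⌊N / (2 : ℝ) ^ (-(L₁ : ℤ) + (j : ℤ))⌋ = B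
  generalize ⌊(T * (2 : ℝ) ^ (-(L₁ : ℤ))) / (2 : ℝ) ^ (-(L₁ : ℤ) + (j : ℤ))⌋ = A
  cases trueCarry L₁ (T * (2 : ℝ) ^ (-(L₁ : ℤ))) N j <;>
    rcases Int.emod_two_eq_zero_or_one A with hA | hA <;>
    rcases Int.emod_two_eq_zero_or_one B with hB | hB <;>
    simp [hA, hB] <;> omega

theorem digit_encode {n : ℕ} (c : EMCode n) (L₁ L₂ : ℕ) (m : c.Msg L₁ L₂) (i : Fin n)
    (l : levels L₁ L₂) : digit l (c.encode L₁ L₂ m i) = (c l).enc (m l) i :=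
  digit_sum_levels L₁ L₂ (fun l => (c l).enc (m l) i) l

/-- If each level decodes its codeword correctly from the noise digits alone, then the successive
decoder finds the message. -/
theorem decode_encode_add {n : ℕ} (c : EMCode n) (L₁ L₂ : ℕ) (m : c.Msg L₁ L₂) (N : Fin n → ℝ)
    (h : ∀ l : levels L₁ L₂, (c l).dec (fun i => xor ((c l).enc (m l) i) (digit l (N i))) = m l) :
    c.decode L₁ L₂ (fun i => c.encode L₁ L₂ m i + N i) = m := by
  set x := c.encode L₁ L₂ m with hx
  set y : Fin n → ℝ := fun i => x i + N i
  have hT : ∀ i, ∃ T : ℕ, x i = T * (2 : ℝ) ^ (-(L₁ : ℤ)) := fun i =>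
    (exists_nat_sum_levels L₁ L₂ fun l => (c l).enc (m l) i).imp fun T hT => hT.1
  have hdigit : ∀ (j : ℕ) (i : Fin n), digit (-(L₁ : ℤ) + j) (y i) =
      xor (xor (digit (-(L₁ : ℤ) + j) (x i)) (digit (-(L₁ : ℤ) + j) (N i)))
        (trueCarry L₁ (x i) (N i) j) := by
    intro j i
    obtain ⟨T, hT⟩ := hT i
    simp only [y]
    rw [hT]
    exact digit_add L₁ T (N i) j
  -- A correct carry cancels by xor, and the level decoder sees its codeword xor the noise digits.
  have hlevel : ∀ (j : ℕ) (hl : -(L₁ : ℤ) + j ∈ levels L₁ L₂),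
      (c.carry L₁ y j = fun i => trueCarry L₁ (x i) (N i) j) →
      c.decodeLevel (-(L₁ : ℤ) + j) (c.carry L₁ y j) y = m ⟨_, hl⟩ := by
    intro j hl hC
    rw [← h ⟨_, hl⟩, EMCode.decodeLevel, hC]
    congr 1
    funext i
    rw [hdigit, ← digit_encode c L₁ L₂ m i ⟨_, hl⟩, ← hx, Bool.xor_assoc, Bool.xor_self,
      Bool.xor_false]
  -- The top level has index `L₁ + L₂`, so each induction step uses `hlevel` strictly below it.
  have hcarry : ∀ j : ℕ, j ≤ L₁ + L₂ →
      c.carry L₁ y j = fun i => trueCarry L₁ (x i) (N i) j := by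
    intro j
    induction j with
    | zero => exact fun _ => rfl
    | succ j ih =>
      intro hj
      have hC := ih (by omega)
      have hl : -(L₁ : ℤ) + j ∈ levels L₁ L₂ := by rw [Finset.mem_Icc]; omega
      funext i
      rw [EMCode.carry, trueCarry]
      simp only [hlevel j hl hC]
      rw [congrFun hC i, hdigit, ← digit_encode c L₁ L₂ m i ⟨_, hl⟩, ← hx]
      congr 1
      cases digit (-(L₁ : ℤ) + j) (x i) <;> cases digit (-(L₁ : ℤ) + j) (N i) <;>
        cases trueCarry L₁ (x i) (N i) j <;> rfl
  funext ⟨l, hl⟩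
  obtain ⟨j, rfl⟩ : ∃ j : ℕ, l = -(L₁ : ℤ) + j :=
    ⟨(l + L₁).toNat, by rw [Finset.mem_Icc] at hl; omega⟩
  have hj : (-(L₁ : ℤ) + j + L₁).toNat = j := by omega
  simp only [EMCode.decode, hj]
  exact hlevel j hl (hcarry j (by rw [Finset.mem_Icc] at hl; omega))

/-! ### The laws of the noise digits -/

theorem measurable_digit (l : ℤ) : Measurable (digit l) := by
  have h : Measurable fun y : ℝ => ⌊y / (2 : ℝ) ^ l⌋ := (measurable_id.div_const _).floor
  exact (measurable_from_top (f := fun k : ℤ => decide (k % 2 = 1))).comp h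

theorem isProbabilityMeasure_bernoulliLaw {q : ℝ} (h0 : 0 ≤ q) (h1 : q ≤ 1) :
    IsProbabilityMeasure (bernoulliLaw q) := by
  constructor
  simp [bernoulliLaw, ← ENNReal.ofReal_add (sub_nonneg.2 h1) h0]

theorem bernoulliLaw_real_singleton {q : ℝ} (h0 : 0 ≤ q) (h1 : q ≤ 1) (b : Bool) :
    (bernoulliLaw q).real {b} = bern q b := by
  cases b <;> simp [bernoulliLaw, measureReal_def, bern, h0, h1]

theorem noiseProb_pos (E_N : ℝ) (l : ℤ) : 0 < noiseProb E_N l := by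
  unfold noiseProb; positivity

theorem noiseProb_lt_one (E_N : ℝ) (l : ℤ) : noiseProb E_N l < 1 := by
  unfold noiseProb
  rw [div_lt_one (by positivity)]
  linarith [Real.exp_pos ((2 : ℝ) ^ l / E_N)]

theorem measure_bool_ext {μ : Measure Bool} [IsProbabilityMeasure μ] {q : ℝ} (h0 : 0 ≤ q)
    (h1 : q ≤ 1) (h : μ.real {true} = q) : μ = bernoulliLaw q := by
  have := isProbabilityMeasure_bernoulliLaw h0 h1
  refine Measure.ext_of_singleton fun b => (measureReal_eq_measureReal_iff).1 ?_
  have hc : ({true} : Set Bool)ᶜ = {false} := by ext b; cases b <;> simp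
  cases b
  · rw [← hc, probReal_compl_eq_one_sub (measurableSet_singleton _),
      probReal_compl_eq_one_sub (measurableSet_singleton _), h,
      bernoulliLaw_real_singleton h0 h1]
    rfl
  · rw [h, bernoulliLaw_real_singleton h0 h1]
    rfl

theorem digit_add_zpow (l : ℤ) (y : ℝ) : digit l (y + (2 : ℝ) ^ l) = !digit l y := by
  simp only [digit]
  rw [add_div, div_self (by positivity), Int.floor_add_one]
  rcases Int.emod_two_eq_zero_or_one ⌊y / (2 : ℝ) ^ l⌋ with h | h <;> simp [h] <;> omega

theorem digit_eq_false_of_lt {l : ℤ} {y : ℝ} (h0 : 0 ≤ y) (h1 : y < (2 : ℝ) ^ l) :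
    digit l y = false := by
  have : ⌊y / (2 : ℝ) ^ l⌋ = 0 := by
    rw [Int.floor_eq_zero_iff]
    exact ⟨by positivity, (div_lt_one (by positivity)).2 h1⟩
  simp [digit, this]

/-- The exponential law is memoryless: shifting by the weight of a digit scales the density. -/
theorem expMeasure_digit_true {r : ℝ} (l : ℤ) :
    expMeasure r {y | digit l y = true} =
      ENNReal.ofReal (Real.exp (-(r * (2 : ℝ) ^ l))) * expMeasure r {y | digit l y = false} := by
  have hm : ∀ b, MeasurableSet {y | digit l y = b} := fun b =>
    measurable_digit l (measurableSet_singleton b)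
  have hd : expMeasure r = volume.withDensity (exponentialPDF r) := rfl
  have hpdf : Measurable (exponentialPDF r) :=
    (measurable_exponentialPDFReal r).ennreal_ofReal
  rw [hd, withDensity_apply _ (hm _), withDensity_apply _ (hm _), ← lintegral_indicator (hm _),
    ← lintegral_indicator (hm _), ← lintegral_const_mul _ (hpdf.indicator (hm _)),
    -- Translation by `2^l` flips the digit, which turns one event into the other.
    ← lintegral_add_right_eq_self _ ((2 : ℝ) ^ l)]
  refine lintegral_congr fun x => ?_
  have hT : (0 : ℝ) < 2 ^ l := by positivity
  simp only [Set.indicator_apply, Set.mem_ofPred_eq, digit_add_zpow, Bool.not_eq_true']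
  split_ifs with h
  · rcases le_or_gt 0 x with hx | hx
    · rw [exponentialPDF_of_nonneg hx, exponentialPDF_of_nonneg (by linarith),
        ← ENNReal.ofReal_mul (Real.exp_pos _).le]
      congr 1
      rw [mul_left_comm, ← Real.exp_add]
      ring_nf
    · rw [exponentialPDF_of_neg hx, mul_zero]
      -- If `x < 0 ≤ x + 2^l`, then `x + 2^l` would lie in `[0, 2^l)`, where the digit is `false`,
      -- not `true`.
      refine exponentialPDF_of_neg (not_le.1 fun h0 => ?_)
      have := digit_eq_false_of_lt (l := l) h0 (by linarith)
      rw [digit_add_zpow, h] at this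
      simp at this
  · simp

/-- The ratio `exp (-2^l / E_N)` of the two digit probabilities, together with their sum one,
determines the law. -/
theorem map_digit_expNoise {E_N : ℝ} (hE : 0 < E_N) (l : ℤ) :
    (expNoise E_N).map (digit l) = bernoulliLaw (noiseProb E_N l) := by
  have hprob : IsProbabilityMeasure (expNoise E_N) :=
    isProbabilityMeasure_expMeasure (one_div_pos.2 hE)
  have := Measure.isProbabilityMeasure_map (μ := expNoise E_N) (measurable_digit l).aemeasurable
  refine measure_bool_ext (noiseProb_pos _ _).le (noiseProb_lt_one _ _).le ?_
  rw [map_measureReal_apply (measurable_digit l) (measurableSet_singleton _)]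
  have h1 : (expNoise E_N).real (digit l ⁻¹' {true}) =
      Real.exp (-(1 / E_N * (2 : ℝ) ^ l)) * (expNoise E_N).real {y | digit l y = false} := by
    rw [measureReal_def, measureReal_def]
    exact (congrArg ENNReal.toReal (expMeasure_digit_true l)).trans (by
      rw [ENNReal.toReal_mul, ENNReal.toReal_ofReal (Real.exp_pos _).le]; rfl)
  have h2 : (expNoise E_N).real {y | digit l y = false} =
      1 - (expNoise E_N).real (digit l ⁻¹' {true}) := by
    rw [← probReal_compl_eq_one_sub (measurable_digit l (measurableSet_singleton _))]
    congr 1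
    ext y
    simp
  rw [h2, show -(1 / E_N * (2 : ℝ) ^ l) = -((2 : ℝ) ^ l / E_N) by ring, Real.exp_neg] at h1
  have hpos := Real.exp_pos ((2 : ℝ) ^ l / E_N)
  rw [noiseProb, eq_div_iff (by positivity)]
  field_simp at h1
  linarith

theorem map_digit_levelNoise (E_N : ℝ) (L₁ L₂ : ℕ) (l : levels L₁ L₂) :
    (levelNoise E_N L₁ L₂).map (digit l) = bernoulliLaw (noiseProb E_N l) := by
  have := fun l : levels L₁ L₂ => isProbabilityMeasure_bernoulliLaw
    (noiseProb_pos E_N l).le (noiseProb_lt_one E_N l).le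
  rw [levelNoise, Measure.map_map (measurable_digit l) (Measurable.of_discrete)]
  have h : (digit l ∘ fun N : levels L₁ L₂ → Bool =>
      ∑ l : levels L₁ L₂, (2 : ℝ) ^ (l : ℤ) * bitVal (N l)) = Function.eval l := by
    funext N
    exact digit_sum_levels L₁ L₂ N l
  rw [h]
  exact (measurePreserving_eval _ l).map_eq

theorem isProbabilityMeasure_levelNoise (E_N : ℝ) (L₁ L₂ : ℕ) :
    IsProbabilityMeasure (levelNoise E_N L₁ L₂) := by
  have := fun l : levels L₁ L₂ => isProbabilityMeasure_bernoulliLaw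
    (noiseProb_pos E_N l).le (noiseProb_lt_one E_N l).le
  exact Measure.isProbabilityMeasure_map Measurable.of_discrete.aemeasurable

/-- Probabilities under independent Bernoulli bits, as finite sums. -/
theorem pi_bernoulliLaw_real {q : ℝ} (h0 : 0 ≤ q) (h1 : q ≤ 1) {n : ℕ}
    (s : Finset (Fin n → Bool)) :
    (Measure.pi fun _ : Fin n => bernoulliLaw q).real s = ∑ z ∈ s, ∏ i, bern q (z i) := by
  have := isProbabilityMeasure_bernoulliLaw h0 h1
  rw [← sum_measureReal_singleton]
  refine Finset.sum_congr rfl fun z _ => ?_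
  simp only [measureReal_def, Measure.pi_singleton, ENNReal.toReal_prod]
  exact Finset.prod_congr rfl fun i _ => bernoulliLaw_real_singleton h0 h1 _

/-- The probability of error of a binary code on a channel whose noise digit is Bernoulli. -/
theorem measure_dec_ne_le {ν : Measure ℝ} [IsProbabilityMeasure ν] {q ε : ℝ} (h0 : 0 ≤ q)
    (h1 : q ≤ 1) {l : ℤ} (hν : ν.map (digit l) = bernoulliLaw q) {n : ℕ} (c : BinaryCode n)
    (m : Fin c.size)
    (h : 1 - ε ≤ ∑ y with c.dec y = m, ∏ i, bern q (xor (c.enc m i) (y i))) :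
    (Measure.pi fun _ : Fin n => ν).real
      {N | c.dec (fun i => xor (c.enc m i) (digit l (N i))) ≠ m} ≤ ε := by
  have := isProbabilityMeasure_bernoulliLaw h0 h1
  have hmap : (Measure.pi fun _ : Fin n => ν).map (fun N i => digit l (N i)) =
      Measure.pi fun _ : Fin n => bernoulliLaw q := by
    have : ∀ _ : Fin n, SigmaFinite (ν.map (digit l)) := fun _ => by rw [hν]; infer_instance
    rw [Measure.pi_map_pi fun _ => (measurable_digit l).aemeasurable, hν]
  have hmeas : Measurable fun (N : Fin n → ℝ) i => digit l (N i) :=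
    measurable_pi_lambda _ fun i => (measurable_digit l).comp (measurable_pi_apply i)
  set G : Finset (Fin n → Bool) := {z | c.dec (fun i => xor (c.enc m i) (z i)) = m} with hG
  have hset : {N : Fin n → ℝ | c.dec (fun i => xor (c.enc m i) (digit l (N i))) ≠ m} =
      (fun (N : Fin n → ℝ) i => digit l (N i)) ⁻¹' (G : Set (Fin n → Bool))ᶜ := by
    ext N
    simp [hG]
  rw [hset, ← map_measureReal_apply hmeas (Set.toFinite _).measurableSet, hmap,
    probReal_compl_eq_one_sub (Set.toFinite _).measurableSet, pi_bernoulliLaw_real h0 h1]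
  -- Xor with the codeword is an involution that exchanges noise words and output words.
  have hinv : ∀ (a : Bool) b, xor a (xor a b) = b := by decide
  have hsum : ∑ z ∈ G, ∏ i, bern q (z i) =
      ∑ y with c.dec y = m, ∏ i, bern q (xor (c.enc m i) (y i)) := by
    refine Finset.sum_bij' (fun z _ i => xor (c.enc m i) (z i))
      (fun y _ i => xor (c.enc m i) (y i)) ?_ ?_ ?_ ?_ ?_ <;> simp [hG, hinv]
  linarith

/-! ### Achievability -/

theorem continuous_binEntropy_binConv (q : ℝ) :
    Continuous fun t => Real.binEntropy (binConv t q) := by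
  unfold binConv
  fun_prop

/-- The coding theorem for the binary symmetric channel with the weight constraint. -/
theorem exists_code_weight_le {p q δ ε : ℝ} (hp : 0 ≤ p) (hp1 : p < 1) (hq : 0 < q)
    (hq1 : q < 1) (hδ : 0 < δ) (hε : 0 < ε) :
    ∀ᶠ n : ℕ in atTop, ∃ c : BinaryCode n,
      (∀ m, p - δ ≤ (∑ i, bitVal (c.enc m i)) / n ∧ (∑ i, bitVal (c.enc m i)) / n ≤ p) ∧
      entropyBits (binConv p q) - entropyBits q - δ ≤ Real.logb 2 c.size / n ∧
      ∀ m, 1 - ε ≤ ∑ y with c.dec y = m, ∏ i, bern q (xor (c.enc m i) (y i)) := by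
  rcases hp.eq_or_lt with rfl | hp
  -- For `p = 0` no smaller positive `p'` exists, but `binConv 0 q = q`, so a single zero codeword
  -- suffices.
  · refine Eventually.of_forall fun n => ⟨⟨1, fun _ _ => false, fun _ => 0⟩, ?_, ?_, fun m => ?_⟩
    · simp [bitVal, hδ.le]
    · simp [binConv, hδ.le]
    · have h : ∑ y : Fin n → Bool, ∏ i, bern q (y i) = 1 := sum_prod_eq_one (sum_bern q) n
      simp [Fin.eq_zero m, h, hε.le]
  have hlog2 : 0 < Real.log 2 := Real.log_pos one_lt_two
  -- In nats, three losses share `δ`: replacing `p` by `p'`, the slack in `exists_code_bsc`, and its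
  -- term `log (ε / 2)`.
  set δ' := δ * Real.log 2 / 3 with hδ'
  have hδ'0 : 0 < δ' := by positivity
  obtain ⟨p', ⟨hp'0, hp'δ, hent⟩, hp'p⟩ : ∃ p', (0 < p' ∧ p - δ / 2 < p' ∧
      Real.binEntropy (binConv p q) - δ' < Real.binEntropy (binConv p' q)) ∧ p' < p := by
    have h1 : ∀ᶠ t in nhds p, 0 < t ∧ p - δ / 2 < t ∧
        Real.binEntropy (binConv p q) - δ' < Real.binEntropy (binConv t q) :=
      (eventually_gt_nhds hp).and ((eventually_gt_nhds (by linarith)).and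
        ((continuous_binEntropy_binConv q).continuousAt.eventually_const_lt (by linarith)))
    exact ((h1.filter_mono nhdsWithin_le_nhds).and
      (self_mem_nhdsWithin : ∀ᶠ t in nhdsWithin p (Set.Iio p), t < p)).exists
  -- Weights are centred at `p' < p`; this tolerance keeps them at most `p` and, as `p' > p - δ /
  -- 2`, at least `p - δ`.
  have hη : 0 < min (p - p') (δ / 2) := lt_min (by linarith) (by linarith)
  have hε' : 0 < min ε 1 := lt_min hε one_pos
  have hlim := tendsto_const_div_atTop_nhds_zero_nat (-Real.log (min ε 1 / 2))
  filter_upwards [exists_code_bsc hp'0 (hp'p.trans hp1) hq hq1 hδ'0 hη hε' (min_le_right _ _),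
    eventually_gt_atTop 0, hlim.eventually_lt_const hδ'0] with n ⟨c, hw, hr, he⟩ hn hl
  have hn' : (0 : ℝ) < n := Nat.cast_pos.2 hn
  refine ⟨c, fun m => ?_, ?_, fun m => ?_⟩
  · have h := abs_lt.1 (hw m)
    simp only [Finset.sum_sub_distrib, Finset.sum_const, Finset.card_univ, Fintype.card_fin,
      nsmul_eq_mul] at h
    rw [le_div_iff₀ hn', div_le_iff₀ hn']
    have h1 := mul_le_mul_of_nonneg_left (min_le_left (p - p') (δ / 2)) hn'.le
    have h2 := mul_le_mul_of_nonneg_left (min_le_right (p - p') (δ / 2)) hn'.le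
    have h3 := mul_lt_mul_of_pos_left hp'δ hn'
    constructor <;> nlinarith
  · rw [div_lt_iff₀ hn'] at hl
    have h1 := mul_lt_mul_of_pos_left hent hn'
    rw [Real.logb, entropyBits, entropyBits, div_div, le_div_iff₀ (by positivity)]
    have h2 : (Real.binEntropy (binConv p q) / Real.log 2 - Real.binEntropy q / Real.log 2 - δ) *
        (Real.log 2 * n) =
        n * (Real.binEntropy (binConv p q) - Real.binEntropy q - 3 * δ') := by
      rw [hδ']
      field_simp
    rw [h2]
    nlinarith
  · exact (sub_le_sub_left (min_le_left _ _) _).trans (he m)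

/-! ### From the level codes to the modulation -/

theorem BinaryCode.size_pos {n : ℕ} (c : BinaryCode n) : 0 < c.size :=
  (c.dec fun _ => false).pos

theorem BinaryCode.onesFraction_mem_Icc {n : ℕ} (c : BinaryCode n) {a b : ℝ}
    (h : ∀ m, a ≤ (∑ i, bitVal (c.enc m i)) / n ∧ (∑ i, bitVal (c.enc m i)) / n ≤ b) :
    a ≤ c.onesFraction ∧ c.onesFraction ≤ b := by
  have hpos : (0 : ℝ) < c.size := Nat.cast_pos.2 c.size_pos
  rw [BinaryCode.onesFraction, le_div_iff₀ hpos, div_le_iff₀ hpos]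
  constructor
  · simpa [mul_comm] using
      Finset.card_nsmul_le_sum Finset.univ _ a fun m _ => (h m).1
  · simpa [mul_comm] using
      Finset.sum_le_card_nsmul Finset.univ _ b fun m _ => (h m).2

variable {n : ℕ} (c : EMCode n) (L₁ L₂ : ℕ)

theorem EMCode.meanInput_le {p : ℤ → ℝ}
    (h : ∀ l ∈ levels L₁ L₂, ∀ m, (∑ i, bitVal ((c l).enc m i)) / n ≤ p l) :
    c.meanInput L₁ L₂ ≤ ∑ l ∈ levels L₁ L₂, (2 : ℝ) ^ l * p l := by
  have : Nonempty (c.Msg L₁ L₂) := ⟨fun l => ⟨0, (c l).size_pos⟩⟩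
  have hpos : (0 : ℝ) < Fintype.card (c.Msg L₁ L₂) := Nat.cast_pos.2 Fintype.card_pos
  have hm : ∀ m : c.Msg L₁ L₂, (∑ i, c.encode L₁ L₂ m i) / (n : ℝ) ≤
      ∑ l ∈ levels L₁ L₂, (2 : ℝ) ^ l * p l := by
    intro m
    simp only [EMCode.encode]
    rw [Finset.sum_comm, Finset.sum_div,
      ← Finset.sum_coe_sort (levels L₁ L₂) fun l => (2 : ℝ) ^ l * p l]
    refine Finset.sum_le_sum fun l _ => ?_
    rw [← Finset.mul_sum, mul_div_assoc]
    exact mul_le_mul_of_nonneg_left (h l l.2 _) (by positivity)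
  rw [EMCode.meanInput, div_le_iff₀ hpos]
  simpa [mul_comm] using Finset.sum_le_card_nsmul Finset.univ _ _ fun m _ => hm m

theorem EMCode.rate_eq :
    c.rate L₁ L₂ = ∑ l ∈ levels L₁ L₂, Real.logb 2 (c l).size / n := by
  rw [EMCode.rate, Fintype.card_pi, Nat.cast_prod,
    Real.logb_prod _ _ fun l _ => by simpa using (c l).size_pos.ne', Finset.sum_div,
    ← Finset.sum_coe_sort (levels L₁ L₂) fun l => Real.logb 2 (c l).size / n]
  simp

/-- The error probability of successive decoding is at most the sum of those of the levels. -/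
theorem avgError_encode_decode_le {ν : Measure ℝ} [IsProbabilityMeasure ν] {q : ℤ → ℝ} {ε : ℝ}
    (hε : 0 ≤ ε) (hq : ∀ l, 0 < q l ∧ q l < 1)
    (hν : ∀ l : levels L₁ L₂, ν.map (digit l) = bernoulliLaw (q l))
    (h : ∀ l ∈ levels L₁ L₂, ∀ m, 1 - ε ≤
      ∑ y with (c l).dec y = m, ∏ i, bern (q l) (xor ((c l).enc m i) (y i))) :
    avgError ν (c.encode L₁ L₂) (c.decode L₁ L₂) ≤ (levels L₁ L₂).card * ε := by
  have hm : ∀ m : c.Msg L₁ L₂, (Measure.pi fun _ : Fin n => ν).real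
      {N | c.decode L₁ L₂ (fun i => c.encode L₁ L₂ m i + N i) ≠ m} ≤
        (levels L₁ L₂).card * ε := by
    intro m
    have hsub : {N : Fin n → ℝ | c.decode L₁ L₂ (fun i => c.encode L₁ L₂ m i + N i) ≠ m} ⊆
        ⋃ l : levels L₁ L₂,
          {N | (c l).dec (fun i => xor ((c l).enc (m l) i) (digit l (N i))) ≠ m l} := by
      intro N hN
      by_contra hcon
      simp only [Set.mem_iUnion, Set.mem_ofPred_eq, not_exists, not_not] at hcon
      exact hN (decode_encode_add c L₁ L₂ m N hcon)
    -- The union bound needs no independence between levels.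
    refine (measureReal_mono hsub).trans ((measureReal_iUnion_fintype_le _).trans ?_)
    refine (Finset.sum_le_card_nsmul Finset.univ _ ε fun l _ => ?_).trans_eq (by simp)
    exact measure_dec_ne_le (hq l).1.le (hq l).2.le (hν l) (c l) (m l) (h l l.2 (m l))
  rw [avgError]
  refine div_le_of_le_mul₀ (Nat.cast_nonneg _) (by positivity) ?_
  refine (Finset.sum_le_card_nsmul Finset.univ _ _ fun m _ => hm m).trans_eq ?_
  rw [nsmul_eq_mul, Finset.card_univ, mul_comm]

end ExpansionModulation

theorem theorem2 (E_N E_X : ℝ) (hE_N : 0 < E_N) (L₁ L₂ : ℕ) (p : ℤ → ℝ)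
    (hp : ∀ l ∈ ExpansionModulation.levels L₁ L₂, 0 ≤ p l ∧ p l ≤ 1 / 2)
    (hE_X : ∑ l ∈ ExpansionModulation.levels L₁ L₂, (2 : ℝ) ^ l * p l ≤ E_X) :
    ExpansionModulation.EMAchieves E_N E_X L₁ L₂ p
      (ExpansionModulation.rateTwo E_N L₁ L₂ p) := by
  open ExpansionModulation in
  intro δ hδ ε hε
  have hcard : 1 ≤ (levels L₁ L₂).card :=
    Finset.card_pos.2 ⟨0, Finset.mem_Icc.2 ⟨by omega, by omega⟩⟩
  have hcard' : (1 : ℝ) ≤ (levels L₁ L₂).card := by exact_mod_cast hcard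
  have hcard0 : (0 : ℝ) < (levels L₁ L₂).card := one_pos.trans_le hcard'
  -- Both `δ` and `ε` are divided equally among the levels.
  have hev := (eventually_all_finset (levels L₁ L₂)).2 fun l hl =>
    exists_code_weight_le (hp l hl).1 ((hp l hl).2.trans_lt one_half_lt_one)
      (noiseProb_pos E_N l) (noiseProb_lt_one E_N l) (div_pos hδ hcard0) (div_pos hε hcard0)
  filter_upwards [hev] with n hn
  -- This lets `choose!` assign a code to the integers outside the levels as well.
  have : Nonempty (BinaryCode n) := ⟨⟨1, fun _ _ => false, fun _ => 0⟩⟩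
  choose! c hw hr he using hn
  have hexp : IsProbabilityMeasure (expNoise E_N) :=
    isProbabilityMeasure_expMeasure (one_div_pos.2 hE_N)
  have hlev := isProbabilityMeasure_levelNoise E_N L₁ L₂
  have hε' : ((levels L₁ L₂).card : ℝ) * (ε / (levels L₁ L₂).card) = ε :=
    mul_div_cancel₀ ε hcard0.ne'
  refine ⟨c, fun l hl => ?_, ?_, ?_, ?_, ?_⟩
  · have h := (c l).onesFraction_mem_Icc (hw l hl)
    exact ⟨(sub_le_sub_left (div_le_self hδ.le hcard') _).trans h.1, h.2⟩
  · rw [EMCode.rate_eq, rateTwo]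
    refine le_trans (le_of_eq ?_) (Finset.sum_le_sum hr)
    rw [Finset.sum_sub_distrib _ fun _ => δ / ((levels L₁ L₂).card : ℝ), Finset.sum_const,
      nsmul_eq_mul, mul_div_cancel₀ δ hcard0.ne']
  · exact (EMCode.meanInput_le c L₁ L₂ fun l hl m => (hw l hl m).2).trans hE_X
  · exact (avgError_encode_decode_le c L₁ L₂ (div_pos hε hcard0).le
      (fun l => ⟨noiseProb_pos E_N l, noiseProb_lt_one E_N l⟩)
      (fun l => map_digit_expNoise hE_N l) he).trans_eq hε'
  · exact (avgError_encode_decode_le c L₁ L₂ (div_pos hε hcard0).le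
      (fun l => ⟨noiseProb_pos E_N l, noiseProb_lt_one E_N l⟩)
      (fun l => map_digit_levelNoise E_N L₁ L₂ l) he).trans_eq hε'
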